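/- **Setting.** Let $\mathcal S,\mathcal A$ be finite sets ($\mathcal A\neq\emptyset$), $\mathbf P_a$ ($a\in\mathcal A$) stochastic matrices on $\mathcal S$, $\mathcal C:\mathcal S\times\mathcal A\to\mathbb R$ a cost, $\mathcal Y\subset\{1,2,\dots\}$ a finite set carrying the law of the i.i.d. channel delays $Y_i$, and $\mathcal Z\subset\mathbb N$ a finite nonempty set of waiting times. A sample of the source $X_t$ taken at time $S_i$ is delivered at $D_i=S_i+Y_i$. At $D_i$ the decision maker, knowing $\mathcal G_i=(X_{S_i},Y_i,A_{i-1})\in\Gamma:=\mathcal S\times\mathcal Y\times\mathcal A$, draws a pair $(Z_i,A_i)\in\mathcal Z\times\mathcal A$ from a law $\phi_i(\mathcal G_i)$. The next sample is taken at $S_{i+1}=D_i+Z_i$. In the slots $D_i\le t<D_{i+1}$ the source moves according to $\mathbf P_{A_i}$ (and according to $\mathbf P_{A_{-1}}$ for $S_0\le t<D_0$); $Y_{i+1}$ is independent of the past and of the source. For $\lambda\in\mathbb R$ and $\mathcal G_0=\gamma_0\in\Gamma$ let $$U(\lambda;\gamma_0)=\inf_{\phi_0,\phi_1,\dots}\ \limsup_{n\to\infty}\frac1n\sum_{i=0}^{n-1}\Big(\mathbb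 E\Big[\sum_{t=D_i}^{D_{i+1}-1}\mathcal C(X_t,A_i)\Big]-\lambda\,\mathbb E[Z_i+Y_{i+1}]\Big).$$ For $\gamma=(s,\delta,a)\in\Gamma$ and $(Z,A)\in\mathcal Z\times\mathcal A$ put $f(Z)=Z+\mathbb E[Y_1]$, $$q(\gamma,A,Z)=\mathbb E\Big[\sum_{s'\in\mathcal S}\Big[\sum_{t=0}^{Z+Y_1-1}\mathbf P_a^{\delta}\mathbf P_A^{t}\Big]_{s,s'}\mathcal C(s',A)\Big],\qquad g(\gamma,A,Z;\lambda)=q(\gamma,A,Z)-\lambda f(Z),$$ and let $\mathbb E[W(\gamma')\mid\gamma,Z,A]$ be taken under $\Pr(\gamma'=(s',\delta',a')\mid\gamma,Z,A)=\Pr(Y_1=\delta')\,[\mathbf P_a^{\delta}\mathbf P_A^{Z}]_{s,s'}\,\mathbf 1\{a'=A\}$. This is the Markov decision process with state space $\Gamma$ and actions $(Z,A)$; call it a unichain if each of its stationary deterministic policies induces a Markov chain with exactly one recurrent class. **Theorem.** Let $\gamma^{\mathrm{ref}}\in\Gamma$ be arbitrary and $h\in\mathbb R$. Consider the system of nonlinear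 equations in $(W,h)$, $W:\Gamma\to\mathbb R$: $$W(\gamma)=\min_{A,Z}\big\{g(\gamma,A,Z;h)+\mathbb E[W(\gamma')\mid\gamma,Z,A]\big\}\quad(\gamma\in\Gamma),\qquad h=\min_{A,Z}\frac{q(\gamma^{\mathrm{ref}},A,Z)+\mathbb E[W(\gamma')\mid\gamma^{\mathrm{ref}},Z,A]}{f(Z)}.\tag{1}$$ 1. $U(h;\gamma_0)=0$ for every initial state $\gamma_0\in\Gamma$ if and only if there is $W$ such that $(W,h)$ solves (1). 2. If the Markov decision process is a unichain, then for each single initial state $\gamma_0$: $U(h;\gamma_0)=0$ if and only if there is $W$ such that $(W,h)$ solves (1). 3. Write $T(W,h)(\gamma)$ and $H(W)$ for the right-hand sides in (1), and $Q(W)=T(W,H(W))$. Then $(W,h)$ solves (1) if and only if $W=Q(W)$ and $h=H(W)$. -/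

import Mathlib

open Filter

/-- Expectation of a real function on a finite probability space. -/
noncomputable def PMF.expect {α : Type*} [Fintype α] (p : PMF α) (f : α → ℝ) : ℝ :=
  ∑ x, (p x).toReal * f x

/-- The data of an age-aware remote Markov decision process, with source states `S` and
control actions `A`: a controlled Markov source, a cost per slot, the law of the i.i.d. channel
delays, which take finitely many values in the positive integers, and the finite nonempty set of
waiting times that the sampler may use. -/
structure RemoteMDP (S A : Type*) where
  /-- law of `X (t + 1)` when `a t = a` and `X t = x` -/
  trans : A → S → PMF S
  /-- cost of one slot -/
  cost : S → A → ℝ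
  /-- possible channel delays -/
  delays : Finset ℕ
  delays_pos : ∀ y ∈ delays, 0 < y
  /-- common law of the channel delays -/
  delayLaw : PMF delays
  /-- possible waiting times -/
  waits : Finset ℕ
  waits_nonempty : waits.Nonempty

namespace RemoteMDP

variable {S A : Type*} (M : RemoteMDP S A)

instance instNonemptyWaits : Nonempty M.waits := M.waits_nonempty.to_subtype

/-- The information `(X_{S_i}, Y_i, A_{i-1})` of the decision maker at the delivery time `D_i`. -/
abbrev State : Type _ := S × M.delays × A

/-- A decision `(Z_i, A_i)`: waiting time and control action. -/
abbrev Decision : Type _ := M.waits × A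

/-- A policy: the law of `(Z_i, A_i)` given `(X_{S_i}, Y_i, A_{i-1})`, for every `i`. -/
abbrev Policy : Type _ := ℕ → M.State → PMF M.Decision

/-! ### The process -/

/-- Law of the source trajectory over `n` slots with constant action `a`, from state `x`
(the state at the beginning and the states after each of the `n` slots). -/
noncomputable def path (a : A) : (n : ℕ) → S → PMF (Fin (n + 1) → S)
  | 0, x => PMF.pure fun _ => x
  | n + 1, x => (M.trans a x).bind fun x' => (path a n x').map (Fin.cons x : _ → Fin (n + 2) → S)

/-- Joint law of the information `(X_{S_i}, Y_i, A_{i-1})` and of the (unobserved) current source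
state `X_{D_i}` under the policy `φ`, when the initial information is `γ₀`.
From `D_i` on the action is `A_i`; the next sample is taken at `S_{i+1} = D_i + Z_i` and is
delivered at `D_{i+1} = S_{i+1} + Y_{i+1}`, where `Y_{i+1}` is independent of the past. -/
noncomputable def law (φ : M.Policy) (γ₀ : M.State) : ℕ → PMF (M.State × S)
  | 0 => (M.path γ₀.2.2 γ₀.2.1 γ₀.1).map fun w => (γ₀, w (Fin.last _))
  | i + 1 =>
    (law φ γ₀ i).bind fun c => (φ i c.1).bind fun d => M.delayLaw.bind fun y =>
      (M.path d.2 ((d.1 : ℕ) + y) c.2).map fun w =>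
        ((w ⟨d.1, by omega⟩, y, d.2), w (Fin.last _))

section

variable [Fintype S] [Fintype A]

/-- `E[∑_{t = D_i}^{D_{i+1} - 1} C(X_t, A_i)]` under the policy `φ`. -/
noncomputable def epochCost (φ : M.Policy) (γ₀ : M.State) (i : ℕ) : ℝ :=
  (M.law φ γ₀ i).expect fun c => (φ i c.1).expect fun d => M.delayLaw.expect fun y =>
    (M.path d.2 ((d.1 : ℕ) + y) c.2).expect fun w =>
      ∑ t : Fin ((d.1 : ℕ) + y), M.cost (w t.castSucc) d.2

/-- `E[Z_i + Y_{i+1}]` under the policy `φ`. -/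
noncomputable def epochLength (φ : M.Policy) (γ₀ : M.State) (i : ℕ) : ℝ :=
  (M.law φ γ₀ i).expect fun c => (φ i c.1).expect fun d => M.delayLaw.expect fun y =>
    ((d.1 : ℕ) : ℝ) + ((y : ℕ) : ℝ)

/-- The optimal value `U(lam)` of the parametrized problem, from the initial information `γ₀`. -/
noncomputable def U (lam : ℝ) (γ₀ : M.State) : ℝ :=
  ⨅ φ : M.Policy, limsup (fun n : ℕ =>
    (1 / (n : ℝ)) * ∑ i ∈ Finset.range n, (M.epochCost φ γ₀ i - lam * M.epochLength φ γ₀ i)) atTop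

/-! ### The equivalent Markov decision process -/

/-- Transition matrix of the source under the action `a`. -/
noncomputable def P (a : A) : Matrix S S ℝ := Matrix.of fun x x' => (M.trans a x x').toReal

/-- Mean duration of an epoch with waiting time `z`. -/
noncomputable def f (z : M.waits) : ℝ :=
  ((z : ℕ) : ℝ) + M.delayLaw.expect fun y => ((y : ℕ) : ℝ)

variable [DecidableEq S]

/-- Mean cost of an epoch. -/
noncomputable def q (γ : M.State) (d : M.Decision) : ℝ :=
  M.delayLaw.expect fun y => ∑ s' : S,
    (∑ t ∈ Finset.range ((d.1 : ℕ) + y), M.P γ.2.2 ^ (γ.2.1 : ℕ) * M.P d.2 ^ t) γ.1 s' *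
      M.cost s' d.2

/-- Cost function of the Markov decision process with parameter `lam`. -/
noncomputable def g (γ : M.State) (d : M.Decision) (lam : ℝ) : ℝ := M.q γ d - lam * M.f d.1

variable [DecidableEq A]

/-- Probability of the transition from `γ` to `γ'` under the decision `d`. -/
noncomputable def transProb (γ : M.State) (d : M.Decision) (γ' : M.State) : ℝ :=
  (M.delayLaw γ'.2.1).toReal * (M.P γ.2.2 ^ (γ.2.1 : ℕ) * M.P d.2 ^ (d.1 : ℕ)) γ.1 γ'.1 *
    if γ'.2.2 = d.2 then 1 else 0

/-- `E[W(γ') | γ, Z, A]`. -/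
noncomputable def nextMean (W : M.State → ℝ) (γ : M.State) (d : M.Decision) : ℝ :=
  ∑ γ' : M.State, M.transProb γ d γ' * W γ'

/-- The state `γ'` is accessible from `γ` in the chain of the stationary deterministic
policy `μ`. -/
def Accessible (μ : M.State → M.Decision) : M.State → M.State → Prop :=
  Relation.ReflTransGen fun γ γ' => 0 < M.transProb γ (μ γ) γ'

/-- Recurrence, in a finite chain: every state accessible from `γ` leads back to `γ`. -/
def Recurrent (μ : M.State → M.Decision) (γ : M.State) : Prop :=
  ∀ γ', M.Accessible μ γ γ' → M.Accessible μ γ' γ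

/-- The Markov decision process is a unichain: under every stationary deterministic policy there
is a single recurrent class (there is always at least one, as the chain is finite). -/
def IsUnichain : Prop :=
  ∀ μ : M.State → M.Decision, ∀ γ γ' : M.State,
    M.Recurrent μ γ → M.Recurrent μ γ' → M.Accessible μ γ γ'

variable [Nonempty A]

/-- The Bellman operator `T(W, h)`. -/
noncomputable def T (W : M.State → ℝ) (h : ℝ) : M.State → ℝ := fun γ =>
  Finset.univ.inf' Finset.univ_nonempty fun d : M.Decision => M.g γ d h + M.nextMean W γ d

/-- The operator `H(W)`, for the reference state `γref`. -/
noncomputable def H (γref : M.State) (W : M.State → ℝ) : ℝ :=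
  Finset.univ.inf' Finset.univ_nonempty fun d : M.Decision =>
    (M.q γref d + M.nextMean W γref d) / M.f d.1

/-- The operator `Q(W) = T(W, H(W))`. -/
noncomputable def Q (γref : M.State) (W : M.State → ℝ) : M.State → ℝ := M.T W (M.H γref W)

/-- The system of nonlinear equations in the unknowns `W` and `h`. -/
def SolvesSystem (γref : M.State) (W : M.State → ℝ) (h : ℝ) : Prop :=
  (∀ γ, W γ = Finset.univ.inf' Finset.univ_nonempty fun d : M.Decision =>
      M.g γ d h + M.nextMean W γ d) ∧
    h = Finset.univ.inf' Finset.univ_nonempty fun d : M.Decision =>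
      (M.q γref d + M.nextMean W γref d) / M.f d.1

end

end RemoteMDP

/-! Averaging out the unobserved source state turns the problem into a finite average-cost decision
process on the information states (`expect_infoLaw_succ`, `epochCost_sub_eq`). In (1), since `f >
0`, the equation for `h` only says `W γref = 0` once the Bellman equation holds; that equation is
invariant under adding constants, so solvability of (1) means solvability of the undiscounted
Bellman equation with parameter `h` (`solvesSystem_iff`).

A Bellman solution forces `U = 0` by telescoping along an arbitrary policy
(`U_eq_zero_of_isOptimal_one`). The converse is a vanishing-discount argument. There are finitely
many stationary policies, so one policy `μ` is discount optimal for factors `β` accumulating at 1.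
Its gain `g` and bias `w` exist by a mean ergodic decomposition, and its discounted value stays
within `2 * ‖w‖` of `g / (1 - β)`. Hence `U = g` (`U_eq_gain`), and if `g = 0` the discounted values
are bounded and a limit point solves the Bellman equation (`exists_isOptimal_one`). In a unichain
`g` is constant, so one initial state suffices. -/

namespace PMF

/-! ### Calculus of expectations on finite spaces. -/

variable {α β : Type*} [Fintype α] [Fintype β]

theorem sum_toReal (p : PMF α) : ∑ x, (p x).toReal = 1 := by
  rw [← ENNReal.toReal_sum fun x _ => p.apply_ne_top x, ← tsum_fintype (L := .unconditional α),
    p.tsum_coe, ENNReal.toReal_one]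

theorem expect_pure (a : α) (f : α → ℝ) : (PMF.pure a).expect f = f a := by
  classical
  simp only [expect, PMF.pure_apply]
  rw [Finset.sum_eq_single a] <;> simp +contextual

theorem expect_bind (p : PMF α) (k : α → PMF β) (f : β → ℝ) :
    (p.bind k).expect f = p.expect fun a => (k a).expect f := by
  have key : ∀ b, ((p.bind k) b).toReal = ∑ a, (p a).toReal * (k a b).toReal := by
    intro b
    rw [PMF.bind_apply, tsum_fintype, ENNReal.toReal_sum]
    · simp
    · exact fun a _ => ENNReal.mul_ne_top (p.apply_ne_top a) ((k a).apply_ne_top b)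
  simp only [expect, key, Finset.sum_mul, Finset.mul_sum]
  rw [Finset.sum_comm]
  simp only [mul_assoc]

theorem expect_map (p : PMF α) (k : α → β) (f : β → ℝ) :
    (p.map k).expect f = p.expect fun a => f (k a) := by
  rw [← PMF.bind_pure_comp, expect_bind]
  simp [expect_pure]

theorem expect_const (p : PMF α) (r : ℝ) : (p.expect fun _ => r) = r := by
  rw [expect, ← Finset.sum_mul, p.sum_toReal, one_mul]

theorem expect_mono (p : PMF α) {f g : α → ℝ} (h : ∀ a, f a ≤ g a) : p.expect f ≤ p.expect g :=
  Finset.sum_le_sum fun a _ => mul_le_mul_of_nonneg_left (h a) ENNReal.toReal_nonneg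

theorem expect_add (p : PMF α) (f g : α → ℝ) :
    (p.expect fun a => f a + g a) = p.expect f + p.expect g := by
  simp only [expect, mul_add, Finset.sum_add_distrib]

theorem expect_sub (p : PMF α) (f g : α → ℝ) :
    (p.expect fun a => f a - g a) = p.expect f - p.expect g := by
  simp only [expect, mul_sub, Finset.sum_sub_distrib]

theorem expect_mul_left (p : PMF α) (r : ℝ) (f : α → ℝ) :
    (p.expect fun a => r * f a) = r * p.expect f := by
  simp only [expect, Finset.mul_sum]
  exact Finset.sum_congr rfl fun a _ => by ring

theorem expect_sum {ι : Type*} (p : PMF α) (s : Finset ι) (f : ι → α → ℝ) :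
    (p.expect fun a => ∑ t ∈ s, f t a) = ∑ t ∈ s, p.expect (f t) := by
  simp only [expect, Finset.mul_sum]
  exact Finset.sum_comm

theorem abs_expect_le (p : PMF α) {f : α → ℝ} {b : ℝ} (h : ∀ a, |f a| ≤ b) :
    |p.expect f| ≤ b := by
  rw [abs_le]
  constructor
  · rw [← p.expect_const (-b)]
    exact p.expect_mono fun a => (abs_le.1 (h a)).1
  · rw [← p.expect_const b]
    exact p.expect_mono fun a => (abs_le.1 (h a)).2

theorem abs_expect_le_norm (p : PMF α) (f : α → ℝ) : |p.expect f| ≤ ‖f‖ :=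
  p.abs_expect_le (norm_le_pi_norm f)

theorem mulVec_expect {ι κ : Type*} [Fintype κ] (N : Matrix ι κ ℝ) (p : PMF α)
    (k : α → κ → ℝ) :
    N.mulVec (fun x => p.expect fun a => k a x) = fun i => p.expect fun a => N.mulVec (k a) i := by
  ext i
  simp only [Matrix.mulVec, dotProduct, expect, Finset.mul_sum]
  rw [Finset.sum_comm]
  exact Finset.sum_congr rfl fun a _ => Finset.sum_congr rfl fun x _ => by ring

end PMF

/-! ### Reduction of the delayed process to a Markov decision process on information states. -/

namespace RemoteMDP

open Matrix

variable {S A : Type*} [Fintype S] (M : RemoteMDP S A)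

theorem expect_trans (a : A) (x : S) (F : S → ℝ) : (M.trans a x).expect F = (M.P a *ᵥ F) x := rfl

theorem expect_path_succ (a : A) (n : ℕ) (x : S) (F : (Fin (n + 2) → S) → ℝ) :
    (M.path a (n + 1) x).expect F =
      (M.P a *ᵥ fun x' => (M.path a n x').expect fun w => F (Fin.cons x w : Fin (n + 2) → S)) x := by
  rw [← M.expect_trans]
  simp only [path, PMF.expect_bind, PMF.expect_map]

variable [DecidableEq S]

/-- Markov property at time `i`, by first-step analysis. Two coordinates are needed because an epoch
yields both the sampled state and the hidden state at delivery. -/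
theorem expect_path_pair (a : A) (n : ℕ) (i : Fin (n + 1)) (x : S) (F : S → S → ℝ) :
    ((M.path a n x).expect fun w => F (w i) (w (Fin.last n))) =
      (M.P a ^ (i : ℕ) *ᵥ fun s => (M.P a ^ (n - i : ℕ) *ᵥ F s) s) x := by
  induction n generalizing x F with
  | zero =>
    obtain rfl : i = 0 := Fin.fin_one_eq_zero i
    simp [path, PMF.expect_pure]
  | succ n ih =>
    rw [expect_path_succ]
    simp only [← Fin.succ_last, Fin.cons_succ]
    refine Fin.cases ?_ (fun j => ?_) i
    · simp only [Fin.cons_zero]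
      -- For `i = 0` the first coordinate is the starting point `x`, so the induction hypothesis is
      -- applied to a function that ignores its first argument.
      have := fun x' => ih 0 x' (fun _ => F x)
      simp only [Fin.val_zero, pow_zero, one_mulVec, Nat.sub_zero] at this ⊢
      simp only [this, pow_succ', ← mulVec_mulVec]
    · simp only [Fin.cons_succ, ih, Fin.val_succ, Nat.add_sub_add_right, pow_succ',
        ← mulVec_mulVec]

omit [DecidableEq S] in
theorem P_mulVec_const (a : A) (r : ℝ) : (M.P a *ᵥ fun _ => r) = fun _ => r := by
  ext x
  rw [← M.expect_trans, PMF.expect_const]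

theorem P_pow_mulVec_const (a : A) (n : ℕ) (r : ℝ) :
    (M.P a ^ n *ᵥ fun _ => r) = fun _ => r := by
  induction n with
  | zero => simp
  | succ n ih => rw [pow_succ, ← mulVec_mulVec, P_mulVec_const, ih]

theorem expect_path_apply (a : A) (n : ℕ) (i : Fin (n + 1)) (x : S) (F : S → ℝ) :
    ((M.path a n x).expect fun w => F (w i)) = (M.P a ^ (i : ℕ) *ᵥ F) x := by
  rw [M.expect_path_pair a n i x fun s _ => F s]
  simp only [P_pow_mulVec_const]

variable [Fintype A]

/-- Given the information `(s, δ, a)` at a delivery, the current source state has the law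
`P_a ^ δ (s, ·)`. -/
theorem expect_law_eq (φ : M.Policy) (γ₀ : M.State) (i : ℕ) (F : M.State × S → ℝ) :
    (M.law φ γ₀ i).expect F = (M.law φ γ₀ i).expect fun c =>
      (M.P c.1.2.2 ^ (c.1.2.1 : ℕ) *ᵥ fun x => F (c.1, x)) c.1.1 := by
  cases i with
  | zero =>
    simp only [law, PMF.expect_map, PMF.expect_const]
    rw [M.expect_path_apply _ _ (Fin.last _) _ fun x => F (γ₀, x)]
    rfl
  | succ i =>
    simp only [law, PMF.expect_bind, PMF.expect_map]
    congr! 6 with c d y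
    rw [M.expect_path_pair _ _ ⟨d.1, by omega⟩ _ fun s x => F ((s, y, d.2), x),
      M.expect_path_apply _ _ ⟨d.1, by omega⟩ _
        fun s => (M.P d.2 ^ (y : ℕ) *ᵥ fun x => F ((s, y, d.2), x)) s]
    simp only [Nat.add_sub_cancel_left]

/-- Law of the information of the decision maker at the `i`-th delivery. -/
noncomputable def infoLaw (φ : M.Policy) (γ₀ : M.State) (i : ℕ) : PMF M.State :=
  (M.law φ γ₀ i).map Prod.fst

omit [DecidableEq S] in
theorem expect_infoLaw_zero (φ : M.Policy) (γ₀ : M.State) (F : M.State → ℝ) :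
    (M.infoLaw φ γ₀ 0).expect F = F γ₀ := by
  simp only [infoLaw, law, PMF.expect_map, PMF.expect_const]

/-- Integrates out the hidden state: the information is a sufficient statistic. -/
theorem expect_infoLaw_law (φ : M.Policy) (γ₀ : M.State) (i : ℕ) (F : M.State → S → ℝ) :
    ((M.law φ γ₀ i).expect fun c => F c.1 c.2) = (M.infoLaw φ γ₀ i).expect fun γ =>
      (M.P γ.2.2 ^ (γ.2.1 : ℕ) *ᵥ F γ) γ.1 := by
  rw [expect_law_eq, infoLaw, PMF.expect_map]

variable [DecidableEq A]

theorem nextMean_eq (W : M.State → ℝ) (γ : M.State) (d : M.Decision) :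
    M.nextMean W γ d = M.delayLaw.expect fun y =>
      ((M.P γ.2.2 ^ (γ.2.1 : ℕ) * M.P d.2 ^ (d.1 : ℕ)) *ᵥ fun s => W (s, y, d.2)) γ.1 := by
  simp only [nextMean, transProb, PMF.expect, mulVec, dotProduct, Finset.mul_sum]
  rw [Fintype.sum_prod_type_right, Fintype.sum_prod_type]
  refine Finset.sum_congr rfl fun y _ => ?_
  rw [Finset.sum_comm]
  refine Finset.sum_congr rfl fun s _ => ?_
  rw [Finset.sum_eq_single d.2]
  · simp; ring
  · intro b _ hb
    simp [hb]
  · simp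

/-- The information process is a controlled Markov chain with kernel `transProb`; the final `y`
slots of an epoch do not affect the sampled state. -/
theorem expect_infoLaw_succ (φ : M.Policy) (γ₀ : M.State) (i : ℕ) (F : M.State → ℝ) :
    (M.infoLaw φ γ₀ (i + 1)).expect F = (M.infoLaw φ γ₀ i).expect fun γ =>
      (φ i γ).expect fun d => M.nextMean F γ d := by
  rw [infoLaw, PMF.expect_map]
  simp only [law, PMF.expect_bind, PMF.expect_map]
  have key (d : M.Decision) (y : M.delays) (x : S) :=
    M.expect_path_apply d.2 (d.1 + y) ⟨d.1, by omega⟩ x fun s => F (s, y, d.2)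
  simp only [key]
  rw [M.expect_infoLaw_law φ γ₀ i fun γ x => (φ i γ).expect fun d => M.delayLaw.expect fun y =>
    (M.P d.2 ^ (d.1 : ℕ) *ᵥ fun s => F (s, y, d.2)) x]
  simp only [PMF.mulVec_expect, mulVec_mulVec, nextMean_eq]

omit [Fintype A] [DecidableEq A] in
theorem q_eq (γ : M.State) (d : M.Decision) :
    M.q γ d = M.delayLaw.expect fun y => ∑ t ∈ Finset.range ((d.1 : ℕ) + y),
      ((M.P γ.2.2 ^ (γ.2.1 : ℕ) * M.P d.2 ^ t) *ᵥ fun s => M.cost s d.2) γ.1 := by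
  simp only [q, mulVec, dotProduct, Matrix.sum_apply, Finset.sum_mul]
  congr! with y
  exact Finset.sum_comm

omit [DecidableEq A] in
theorem epochCost_eq (φ : M.Policy) (γ₀ : M.State) (i : ℕ) :
    M.epochCost φ γ₀ i = (M.infoLaw φ γ₀ i).expect fun γ => (φ i γ).expect fun d => M.q γ d := by
  have key : ∀ (d : M.Decision) (y : M.delays) (x : S),
      ((M.path d.2 ((d.1 : ℕ) + y) x).expect fun w =>
        ∑ t : Fin ((d.1 : ℕ) + y), M.cost (w t.castSucc) d.2) =
      ∑ t ∈ Finset.range ((d.1 : ℕ) + y), (M.P d.2 ^ t *ᵥ fun s => M.cost s d.2) x := by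
    intro d y x
    rw [PMF.expect_sum, Finset.sum_range]
    refine Finset.sum_congr rfl fun t _ => ?_
    exact M.expect_path_apply _ _ t.castSucc _ fun s => M.cost s d.2
  simp only [epochCost, key]
  rw [M.expect_infoLaw_law φ γ₀ i fun γ x => (φ i γ).expect fun d => M.delayLaw.expect fun y =>
    ∑ t ∈ Finset.range ((d.1 : ℕ) + y), (M.P d.2 ^ t *ᵥ fun s => M.cost s d.2) x]
  simp only [PMF.mulVec_expect, q_eq]
  congr! with γ d y
  rw [← Finset.sum_fn, Matrix.mulVec_sum, Finset.sum_apply]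
  simp only [mulVec_mulVec]

omit [DecidableEq S] [DecidableEq A] in
theorem epochLength_eq (φ : M.Policy) (γ₀ : M.State) (i : ℕ) :
    M.epochLength φ γ₀ i = (M.infoLaw φ γ₀ i).expect fun γ => (φ i γ).expect fun d => M.f d.1 := by
  simp only [epochLength, infoLaw, PMF.expect_map, f, PMF.expect_add, PMF.expect_const]

omit [DecidableEq A] in
theorem epochCost_sub_eq (φ : M.Policy) (γ₀ : M.State) (lam : ℝ) (i : ℕ) :
    M.epochCost φ γ₀ i - lam * M.epochLength φ γ₀ i =
      (M.infoLaw φ γ₀ i).expect fun γ => (φ i γ).expect fun d => M.g γ d lam := by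
  rw [epochCost_eq, epochLength_eq, ← PMF.expect_mul_left, ← PMF.expect_sub]
  simp only [← PMF.expect_mul_left, ← PMF.expect_sub, g]

end RemoteMDP

/-! ### Mean ergodic decomposition and resolvent bound for contractions. -/

section PowerBounded

variable {E : Type*} [NormedAddCommGroup E] [NormedSpace ℝ E]

/-- Telescoping gives `n • g = w - L^n w`, which stays bounded by `2 * ‖w‖`. -/
theorem eq_zero_of_fixed_of_coboundary (L : E →ₗ[ℝ] E) (hL : ∀ x, ‖L x‖ ≤ ‖x‖) {g w : E}
    (hg : L g = g) (hw : w - L w = g) : g = 0 := by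
  have key : ∀ n : ℕ, ∃ x : E, ‖x‖ ≤ ‖w‖ ∧ (n : ℝ) • g = w - x ∧ L x = x - g := by
    intro n
    induction n with
    | zero => exact ⟨w, le_rfl, by simp, by rw [← hw]; abel⟩
    | succ n ih =>
      obtain ⟨x, hx, hn, hLx⟩ := ih
      refine ⟨L x, (hL x).trans hx, ?_, ?_⟩
      · rw [hLx, Nat.cast_succ, add_smul, hn, one_smul]
        abel
      · conv_lhs => rw [hLx, map_sub, hg]
  by_contra h0
  obtain ⟨n, hn⟩ := exists_nat_gt (2 * ‖w‖ / ‖g‖)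
  obtain ⟨x, hx, hng, -⟩ := key n
  rw [div_lt_iff₀ (norm_pos_iff.2 h0)] at hn
  have h1 : ‖(n : ℝ) • g‖ = n * ‖g‖ := by rw [norm_smul, Real.norm_natCast]
  have h2 := norm_sub_le w x
  rw [← hng, h1] at h2
  linarith

/-- For a contraction `L` of a finite-dimensional space, every vector is the sum of a fixed vector
and of a coboundary `w - L w`. -/
theorem exists_fixed_add_coboundary [FiniteDimensional ℝ E] (L : E →ₗ[ℝ] E)
    (hL : ∀ x, ‖L x‖ ≤ ‖x‖) (r : E) : ∃ g w, L g = g ∧ r = g + (w - L w) := by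
  set N : E →ₗ[ℝ] E := LinearMap.id - L
  have hdisj : Disjoint (LinearMap.ker N) (LinearMap.range N) := by
    rw [Submodule.disjoint_def]
    rintro g hg ⟨w, hw⟩
    exact eq_zero_of_fixed_of_coboundary L hL (sub_eq_zero.1 hg).symm hw
  -- By rank-nullity, the disjoint kernel and range of `id - L` span the whole space.
  have htop := Submodule.eq_top_of_disjoint _ _
    (by rw [add_comm, N.finrank_range_add_finrank_ker]) hdisj
  obtain ⟨g, hg, -, ⟨w, rfl⟩, h⟩ := Submodule.mem_sup.1 (htop ▸ Submodule.mem_top (x := r))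
  exact ⟨g, w, (sub_eq_zero.1 hg).symm, h.symm⟩

/-- Removing the pole `(1 - β)⁻¹ • g` and then `w` leaves `e = β • L e - (1 - β) • L w`, so `‖e‖ ≤
‖w‖`. The point is that the bound does not depend on `β`. -/
theorem norm_resolvent_sub_le (L : E →ₗ[ℝ] E) (hL : ∀ x, ‖L x‖ ≤ ‖x‖) {g w v : E} {β : ℝ}
    (h0 : 0 ≤ β) (h1 : β < 1) (hg : L g = g) (hv : v = g + (w - L w) + β • L v) :
    ‖v - (1 - β)⁻¹ • g‖ ≤ 2 * ‖w‖ := by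
  have hb : (1 - β) ≠ 0 := by linarith
  set e := v - (1 - β)⁻¹ • g - w with he
  have hve : v = e + (1 - β)⁻¹ • g + w := by rw [he]; abel
  have hgb : (1 - β)⁻¹ • g = g + β • (1 - β)⁻¹ • g := by
    have : g = (1 : ℝ) • g := (one_smul _ _).symm
    conv_rhs => rw [this]
    rw [smul_smul, smul_smul, ← add_smul]
    congr 1
    field_simp
    ring
  have hLv : L v = L e + (1 - β)⁻¹ • g + L w := by
    rw [hve, map_add, map_add, map_smul, hg]
  have heq : e = β • L e - (1 - β) • L w := by
    calc e = v - (1 - β)⁻¹ • g - w := rfl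
      _ = g + (w - L w) + β • L v - (g + β • (1 - β)⁻¹ • g) - w := by rw [← hgb, ← hv]
      _ = β • L e - (1 - β) • L w := by
        rw [hLv]
        module
  have hn : ‖e‖ ≤ β * ‖e‖ + (1 - β) * ‖w‖ := by
    calc ‖e‖ ≤ ‖β • L e‖ + ‖(1 - β) • L w‖ := by
          conv_lhs => rw [heq]
          exact norm_sub_le _ _
      _ = β * ‖L e‖ + (1 - β) * ‖L w‖ := by
          rw [norm_smul, norm_smul, Real.norm_of_nonneg h0, Real.norm_of_nonneg (by linarith)]
      _ ≤ _ := by gcongr <;> exact hL _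
  have hew : ‖e‖ ≤ ‖w‖ := by
    have : (1 - β) * ‖e‖ ≤ (1 - β) * ‖w‖ := by linarith
    exact le_of_mul_le_mul_left this (by linarith)
  calc ‖v - (1 - β)⁻¹ • g‖ = ‖e + w‖ := by rw [he]; congr 1; abel
    _ ≤ ‖e‖ + ‖w‖ := norm_add_le _ _
    _ ≤ _ := by linarith

end PowerBounded

/-! ### Real sequences: from averages to partial and discounted sums. -/

/-- Summation by parts: discounted sums inherit an upper bound on all partial sums. -/
theorem sum_pow_mul_le_of_sum_le {b : ℕ → ℝ} {C β : ℝ} (h0 : 0 ≤ β) (h1 : β ≤ 1)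
    (hb : ∀ n, ∑ i ∈ Finset.range n, b i ≤ C) (n : ℕ) :
    ∑ i ∈ Finset.range n, β ^ i * b i ≤ C := by
  have key : ∑ i ∈ Finset.range n, β ^ i * b i ≤
      C * (1 - β ^ n) + β ^ n * ∑ i ∈ Finset.range n, b i := by
    induction n with
    | zero => simp
    | succ n ih =>
      rw [Finset.sum_range_succ]
      have h2 : 0 ≤ (C - ∑ i ∈ Finset.range (n + 1), b i) * (β ^ n * (1 - β)) :=
        mul_nonneg (sub_nonneg.2 (hb _)) (mul_nonneg (pow_nonneg h0 n) (by linarith))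
      have h3 := Finset.sum_range_succ b n
      rw [pow_succ]
      rw [h3] at h2 ⊢
      linarith
  nlinarith [hb n, pow_nonneg h0 n]

/-- A bounded sequence whose averages have upper limit less than `ε` has all its partial sums below
`ε * n + C`. -/
theorem exists_sum_le_of_limsup_lt {a : ℕ → ℝ} {B ε : ℝ} (hB : ∀ i, |a i| ≤ B)
    (h : limsup (fun n : ℕ => (1 / (n : ℝ)) * ∑ i ∈ Finset.range n, a i) atTop < ε) :
    ∃ C, ∀ n : ℕ, ∑ i ∈ Finset.range n, (a i - ε) ≤ C := by
  have hB0 : 0 ≤ B := (abs_nonneg _).trans (hB 0)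
  have habs : ∀ n : ℕ, |∑ i ∈ Finset.range n, a i| ≤ n * B := fun n =>
    (Finset.abs_sum_le_sum_abs _ _).trans
      ((Finset.sum_le_sum fun i _ => hB i).trans (by simp))
  have hbdd : IsBoundedUnder (· ≤ ·) atTop
      fun n : ℕ => (1 / (n : ℝ)) * ∑ i ∈ Finset.range n, a i := by
    refine isBoundedUnder_of ⟨B, fun n => ?_⟩
    rcases n.eq_zero_or_pos with rfl | hn
    · simpa using hB0
    · have hn' : (0 : ℝ) < n := by exact_mod_cast hn
      rw [one_div, inv_mul_le_iff₀ hn']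
      exact (le_abs_self _).trans (habs n)
  obtain ⟨N, hN⟩ := eventually_atTop.1 (eventually_lt_of_limsup_lt h hbdd)
  -- From `N` on the partial sums are at most 0; before that each term is at most `B + |ε|`.
  refine ⟨N * (B + |ε|), fun n => ?_⟩
  rw [Finset.sum_sub_distrib, Finset.sum_const, Finset.card_range, nsmul_eq_mul]
  have hNe : 0 ≤ (N : ℝ) * (B + |ε|) := by positivity
  rcases le_or_gt N n with hn | hn
  · rcases n.eq_zero_or_pos with rfl | hn0
    · simpa using hNe
    · have hn' : (0 : ℝ) < n := by exact_mod_cast hn0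
      have h2 := hN n hn
      rw [one_div, inv_mul_lt_iff₀ hn'] at h2
      linarith
  · have h2 := (le_abs_self _).trans (habs n)
    have h3 : (n : ℝ) ≤ N := by exact_mod_cast hn.le
    have h4 : (n : ℝ) * (B + |ε|) ≤ N * (B + |ε|) := by gcongr
    have h5 : -((n : ℝ) * ε) ≤ n * |ε| := by
      rw [← mul_neg]
      gcongr
      exact neg_le_abs ε
    linarith

/-! ### The discounted problem. -/

namespace RemoteMDP

open Matrix

variable {S A : Type*} [Fintype S] (M : RemoteMDP S A)

omit [Fintype S] in
theorem P_nonneg (a : A) (x x' : S) : 0 ≤ M.P a x x' := ENNReal.toReal_nonneg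

variable [DecidableEq S]

theorem P_pow_nonneg (a : A) (n : ℕ) (x x' : S) : 0 ≤ (M.P a ^ n) x x' := by
  induction n generalizing x x' with
  | zero => rw [pow_zero, one_apply]; positivity
  | succ n ih =>
    rw [pow_succ, mul_apply]
    exact Finset.sum_nonneg fun y _ => mul_nonneg (ih _ _) (M.P_nonneg _ _ _)

variable [Fintype A] [DecidableEq A]

omit [Fintype A] in
theorem transProb_nonneg (γ : M.State) (d : M.Decision) (γ' : M.State) :
    0 ≤ M.transProb γ d γ' := by
  refine mul_nonneg (mul_nonneg ENNReal.toReal_nonneg ?_) (by positivity)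
  rw [mul_apply]
  exact Finset.sum_nonneg fun y _ => mul_nonneg (M.P_pow_nonneg _ _ _ _) (M.P_pow_nonneg _ _ _ _)

theorem nextMean_const (r : ℝ) (γ : M.State) (d : M.Decision) :
    M.nextMean (fun _ => r) γ d = r := by
  rw [nextMean_eq]
  simp only [← mulVec_mulVec, P_pow_mulVec_const, PMF.expect_const]

theorem sum_transProb (γ : M.State) (d : M.Decision) : ∑ γ', M.transProb γ d γ' = 1 := by
  simpa [nextMean] using M.nextMean_const 1 γ d

theorem nextMean_mono {V W : M.State → ℝ} (h : ∀ γ, V γ ≤ W γ) (γ : M.State) (d : M.Decision) :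
    M.nextMean V γ d ≤ M.nextMean W γ d :=
  Finset.sum_le_sum fun γ' _ => mul_le_mul_of_nonneg_left (h γ') (M.transProb_nonneg _ _ _)

theorem nextMean_sub (V W : M.State → ℝ) (γ : M.State) (d : M.Decision) :
    M.nextMean (fun γ' => V γ' - W γ') γ d = M.nextMean V γ d - M.nextMean W γ d := by
  simp only [nextMean, mul_sub, Finset.sum_sub_distrib]

theorem abs_nextMean_le (W : M.State → ℝ) (γ : M.State) (d : M.Decision) :
    |M.nextMean W γ d| ≤ ‖W‖ := by
  rw [abs_le, ← M.nextMean_const (-‖W‖) γ d]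
  have h := fun γ => abs_le.1 (norm_le_pi_norm W γ)
  refine ⟨M.nextMean_mono (fun γ => (h γ).1) γ d, ?_⟩
  conv_rhs => rw [← M.nextMean_const ‖W‖ γ d]
  exact M.nextMean_mono (fun γ => (h γ).2) γ d

/-- Transition operator of the chain of the stationary deterministic policy `μ`. -/
noncomputable def stepMap (μ : M.State → M.Decision) : (M.State → ℝ) →ₗ[ℝ] (M.State → ℝ) where
  toFun W γ := M.nextMean W γ (μ γ)
  map_add' V W := by ext γ; simp [nextMean, mul_add, Finset.sum_add_distrib]
  map_smul' r W := by
    ext γ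
    simp only [nextMean, Pi.smul_apply, smul_eq_mul, Finset.mul_sum, RingHom.id_apply]
    exact Finset.sum_congr rfl fun _ _ => by ring

theorem stepMap_apply (μ : M.State → M.Decision) (W : M.State → ℝ) (γ : M.State) :
    M.stepMap μ W γ = M.nextMean W γ (μ γ) := rfl

theorem norm_stepMap_le (μ : M.State → M.Decision) (W : M.State → ℝ) : ‖M.stepMap μ W‖ ≤ ‖W‖ :=
  (pi_norm_le_iff_of_nonneg (norm_nonneg W)).2 fun γ => M.abs_nextMean_le W γ (μ γ)

/-- The Bellman equation with discount factor `β` for the value `v`, the minima being attained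
by the decisions of `μ`. -/
structure IsOptimal (lam β : ℝ) (μ : M.State → M.Decision) (v : M.State → ℝ) : Prop where
  le : ∀ γ d, v γ ≤ M.g γ d lam + β * M.nextMean v γ d
  eq : ∀ γ, v γ = M.g γ (μ γ) lam + β * M.nextMean v γ (μ γ)

/-- The Bellman operator is a `β`-contraction in the sup norm: a decision that is minimal for `W`
also bounds the minimum for `V`. Minimizers at the fixed point define `μ`. -/
theorem exists_isOptimal [Nonempty A] (lam : ℝ) {β : ℝ} (h0 : 0 ≤ β) (h1 : β < 1) :
    ∃ μ v, M.IsOptimal lam β μ v := by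
  set B : (M.State → ℝ) → M.State → ℝ := fun v γ =>
    Finset.univ.inf' Finset.univ_nonempty fun d : M.Decision =>
      M.g γ d lam + β * M.nextMean v γ d with hBdef
  have key : ∀ V W γ, B V γ - B W γ ≤ β * dist V W := by
    intro V W γ
    obtain ⟨d, -, hd⟩ := Finset.exists_mem_eq_inf' Finset.univ_nonempty fun d : M.Decision =>
      M.g γ d lam + β * M.nextMean W γ d
    have h2 : B V γ ≤ M.g γ d lam + β * M.nextMean V γ d := Finset.inf'_le _ (Finset.mem_univ d)
    have h3 : B W γ = M.g γ d lam + β * M.nextMean W γ d := hd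
    have h4 := (le_abs_self _).trans (M.abs_nextMean_le (V - W) γ d)
    have h5 : M.nextMean (V - W) γ d = M.nextMean V γ d - M.nextMean W γ d :=
      M.nextMean_sub V W γ d
    rw [h5, ← dist_eq_norm] at h4
    have := mul_le_mul_of_nonneg_left h4 h0
    linarith
  have hc : ContractingWith ⟨β, h0⟩ B := by
    refine ⟨h1, LipschitzWith.of_dist_le_mul fun V W => ?_⟩
    refine (dist_pi_le_iff (mul_nonneg h0 dist_nonneg)).2 fun γ => ?_
    rw [Real.dist_eq, abs_le]
    have h2 := key W V γ
    rw [dist_comm] at h2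
    exact ⟨by simpa using (by linarith : -(β * dist V W) ≤ B V γ - B W γ), key V W γ⟩
  obtain ⟨v, hv, -⟩ := hc.exists_fixedPoint 0 (edist_ne_top _ _)
  have hmin : ∀ γ, ∃ d, v γ = M.g γ d lam + β * M.nextMean v γ d := by
    intro γ
    obtain ⟨d, -, hd⟩ := Finset.exists_mem_eq_inf' Finset.univ_nonempty fun d : M.Decision =>
      M.g γ d lam + β * M.nextMean v γ d
    exact ⟨d, (congrFun hv γ).symm.trans hd⟩
  choose μ hμ using hmin
  refine ⟨μ, v, fun γ d => ?_, hμ⟩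
  rw [← congrFun hv γ]
  exact Finset.inf'_le _ (Finset.mem_univ d)

open Topology in
/-- A single stationary policy is discount optimal for discount factors arbitrarily close to 1. -/
theorem exists_frequently_isOptimal [Nonempty A] (lam : ℝ) :
    ∃ μ, ∃ᶠ β in 𝓝[<] (1 : ℝ), 0 ≤ β ∧ β < 1 ∧ ∃ v, M.IsOptimal lam β μ v := by
  by_contra! hcon
  -- Pigeonhole: finitely many policies, each failing eventually, would all fail together at some
  -- `β`.
  have h1 := eventually_all.2 hcon
  have h2 : ∀ᶠ β in 𝓝[<] (1 : ℝ), β ∈ Set.Ioo (0 : ℝ) 1 := Ioo_mem_nhdsLT one_pos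
  obtain ⟨β, hβ, hβ'⟩ := (h1.and h2).exists
  obtain ⟨μ, v, hv⟩ := M.exists_isOptimal lam hβ'.1.le hβ'.2
  exact hβ μ hβ'.1.le hβ'.2 v hv

/-- Mean cost, reduced by `lam` per slot, of the `i`-th epoch. -/
noncomputable def reducedCost (lam : ℝ) (φ : M.Policy) (γ₀ : M.State) (i : ℕ) : ℝ :=
  M.epochCost φ γ₀ i - lam * M.epochLength φ γ₀ i

omit [DecidableEq A] in
theorem exists_abs_reducedCost_le (lam : ℝ) :
    ∃ B, ∀ (φ : M.Policy) (γ₀ : M.State) (i : ℕ), |M.reducedCost lam φ γ₀ i| ≤ B := by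
  refine ⟨‖fun c : M.State × M.Decision => M.g c.1 c.2 lam‖, fun φ γ₀ i => ?_⟩
  rw [reducedCost, epochCost_sub_eq]
  exact PMF.abs_expect_le _ fun γ => PMF.abs_expect_le _ fun d =>
    norm_le_pi_norm (fun c : M.State × M.Decision => M.g c.1 c.2 lam) (γ, d)

/-- Iterates the Bellman inequality along an arbitrary randomized policy. The case `β = 1` is
included and serves the verification argument. -/
theorem IsOptimal.le_sum {M : RemoteMDP S A} {lam β : ℝ} {μ : M.State → M.Decision}
    {v : M.State → ℝ} (hv : M.IsOptimal lam β μ v) (h0 : 0 ≤ β) (φ : M.Policy) (γ₀ : M.State)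
    (n : ℕ) : v γ₀ ≤ ∑ i ∈ Finset.range n, β ^ i * M.reducedCost lam φ γ₀ i +
      β ^ n * (M.infoLaw φ γ₀ n).expect v := by
  induction n with
  | zero => simp [expect_infoLaw_zero]
  | succ n ih =>
    have h1 : (M.infoLaw φ γ₀ n).expect v ≤ M.reducedCost lam φ γ₀ n +
        β * (M.infoLaw φ γ₀ (n + 1)).expect v := by
      rw [reducedCost, epochCost_sub_eq, expect_infoLaw_succ]
      simp only [← PMF.expect_mul_left, ← PMF.expect_add]
      refine PMF.expect_mono _ fun γ => ?_
      rw [← PMF.expect_const (φ n γ) (v γ)]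
      exact PMF.expect_mono _ fun d => hv.le γ d
    have h2 := mul_le_mul_of_nonneg_left h1 (pow_nonneg h0 n)
    rw [Finset.sum_range_succ, pow_succ]
    linarith

end RemoteMDP

/-! ### Gain, bias and the vanishing-discount limit. -/

namespace RemoteMDP

open Matrix Topology

variable {S A : Type*} [Fintype S] [DecidableEq S] [Fintype A] [DecidableEq A]

/-- The Poisson equation of the stationary policy `μ`: its gain is `g` and its bias is `w`. -/
structure IsGainBias (M : RemoteMDP S A) (lam : ℝ) (μ : M.State → M.Decision)
    (g w : M.State → ℝ) : Prop where
  fixed : M.stepMap μ g = g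
  poisson : (fun γ => M.g γ (μ γ) lam) = g + (w - M.stepMap μ w)

/-- Average reduced cost of the first `n` epochs. -/
noncomputable def averageCost (M : RemoteMDP S A) (lam : ℝ) (φ : M.Policy) (γ₀ : M.State)
    (n : ℕ) : ℝ :=
  (1 / (n : ℝ)) * ∑ i ∈ Finset.range n, M.reducedCost lam φ γ₀ i

variable {M : RemoteMDP S A} {lam : ℝ} {μ : M.State → M.Decision} {g w : M.State → ℝ}

theorem exists_isGainBias (M : RemoteMDP S A) (lam : ℝ) (μ : M.State → M.Decision) :
    ∃ g w, M.IsGainBias lam μ g w :=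
  let ⟨g, w, hg, hw⟩ := exists_fixed_add_coboundary (M.stepMap μ) (M.norm_stepMap_le μ)
    fun γ => M.g γ (μ γ) lam
  ⟨g, w, hg, hw⟩

/-- The gain is harmonic, so its mean stays `g γ₀`; the bias terms telescope. -/
theorem IsGainBias.sum_eq (hg : M.IsGainBias lam μ g w) (γ₀ : M.State) (n : ℕ) :
    ∑ i ∈ Finset.range n, M.reducedCost lam (fun _ γ => PMF.pure (μ γ)) γ₀ i =
      n * g γ₀ + w γ₀ - (M.infoLaw (fun _ γ => PMF.pure (μ γ)) γ₀ n).expect w := by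
  set φ : M.Policy := fun _ γ => PMF.pure (μ γ)
  have hstep : ∀ i F, (M.infoLaw φ γ₀ (i + 1)).expect F =
      (M.infoLaw φ γ₀ i).expect (M.stepMap μ F) := by
    intro i F
    rw [expect_infoLaw_succ]
    simp only [φ, PMF.expect_pure, ← stepMap_apply]
  have hfix : ∀ i, (M.infoLaw φ γ₀ i).expect g = g γ₀ := by
    intro i
    induction i with
    | zero => rw [expect_infoLaw_zero]
    | succ i ih => rw [hstep, hg.fixed, ih]
  induction n with
  | zero => simp [expect_infoLaw_zero]
  | succ n ih =>
    have h1 : M.reducedCost lam φ γ₀ n = g γ₀ + ((M.infoLaw φ γ₀ n).expect w -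
        (M.infoLaw φ γ₀ (n + 1)).expect w) := by
      rw [reducedCost, epochCost_sub_eq, hstep, ← hfix n, ← PMF.expect_sub, ← PMF.expect_add]
      congr 1
      ext γ
      simp only [φ, PMF.expect_pure]
      exact congrFun hg.poisson γ
    rw [Finset.sum_range_succ, ih, h1]
    push_cast
    ring

theorem IsGainBias.tendsto_averageCost (hg : M.IsGainBias lam μ g w) (γ₀ : M.State) :
    Tendsto (M.averageCost lam (fun _ γ => PMF.pure (μ γ)) γ₀) atTop (𝓝 (g γ₀)) := by
  have h1 : Tendsto (fun n : ℕ => (2 * ‖w‖) / (n : ℝ)) atTop (𝓝 0) :=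
    tendsto_const_div_atTop_nhds_zero_nat _
  refine tendsto_iff_dist_tendsto_zero.2 (squeeze_zero' (Eventually.of_forall fun _ => dist_nonneg)
    ?_ h1)
  filter_upwards [eventually_gt_atTop 0] with n hn
  have hn' : (0 : ℝ) < n := by exact_mod_cast hn
  have h2 := PMF.abs_expect_le_norm (M.infoLaw (fun _ γ => PMF.pure (μ γ)) γ₀ n) w
  have h3 : |w γ₀| ≤ ‖w‖ := norm_le_pi_norm w γ₀
  rw [averageCost, hg.sum_eq, Real.dist_eq]
  set e := (M.infoLaw (fun _ γ => PMF.pure (μ γ)) γ₀ n).expect w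
  have h4 : 1 / (n : ℝ) * (n * g γ₀ + w γ₀ - e) - g γ₀ = (w γ₀ - e) / n := by
    field_simp
    ring
  rw [h4, abs_div, abs_of_pos hn']
  gcongr
  exact (abs_sub _ _).trans (by linarith)

theorem U_eq_of_forall_le (hg : M.IsGainBias lam μ g w) (γ₀ : M.State)
    (h : ∀ φ : M.Policy, g γ₀ ≤ limsup (M.averageCost lam φ γ₀) atTop) : M.U lam γ₀ = g γ₀ := by
  have : Nonempty M.Policy := ⟨fun _ γ => PMF.pure (μ γ)⟩
  refine le_antisymm ?_ (le_ciInf h)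
  rw [← (hg.tendsto_averageCost γ₀).limsup_eq]
  -- The lower bound over all policies also makes the real infimum genuine.
  exact ciInf_le ⟨g γ₀, Set.forall_mem_range.2 h⟩ _

omit [DecidableEq A] in
theorem le_limsup_of_forall_sum_le {φ : M.Policy} {γ₀ : M.State} {r : ℝ}
    (h : ∀ ε C, (∀ n : ℕ, ∑ i ∈ Finset.range n, (M.reducedCost lam φ γ₀ i - ε) ≤ C) → r ≤ ε) :
    r ≤ limsup (M.averageCost lam φ γ₀) atTop := by
  obtain ⟨B, hB⟩ := M.exists_abs_reducedCost_le lam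
  refine le_of_forall_gt_imp_ge_of_dense fun ε hε => ?_
  obtain ⟨C, hC⟩ := exists_sum_le_of_limsup_lt (hB φ γ₀) hε
  exact h ε C hC

theorem IsGainBias.abs_sub_le (hg : M.IsGainBias lam μ g w) {β : ℝ} {v : M.State → ℝ}
    (h0 : 0 ≤ β) (h1 : β < 1) (hv : M.IsOptimal lam β μ v) (γ : M.State) :
    |v γ - (1 - β)⁻¹ * g γ| ≤ 2 * ‖w‖ := by
  refine (norm_le_pi_norm (v - (1 - β)⁻¹ • g) γ).trans
    (norm_resolvent_sub_le (M.stepMap μ) (M.norm_stepMap_le μ) h0 h1 hg.fixed ?_)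
  rw [← hg.poisson]
  ext γ
  exact hv.eq γ

/-- Abelian comparison: a bound on undiscounted partial sums passes to discounted ones, and the
remainder `β ^ n * ‖v‖` vanishes as `n` grows. -/
theorem IsOptimal.mul_le {β ε C : ℝ} {v : M.State → ℝ} (hv : M.IsOptimal lam β μ v) (h0 : 0 ≤ β)
    (h1 : β < 1) {φ : M.Policy} {γ₀ : M.State}
    (hC : ∀ n : ℕ, ∑ i ∈ Finset.range n, (M.reducedCost lam φ γ₀ i - ε) ≤ C) :
    (1 - β) * v γ₀ ≤ ε + (1 - β) * C := by
  have hb : 0 < 1 - β := by linarith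
  have key : ∀ n : ℕ, (1 - β) * v γ₀ ≤
      (1 - β) * C + ε * (1 - β ^ n) + (1 - β) * (β ^ n * ‖v‖) := by
    intro n
    have h2 := hv.le_sum h0 φ γ₀ n
    have h3 := sum_pow_mul_le_of_sum_le h0 h1.le hC n
    simp only [mul_sub, Finset.sum_sub_distrib, ← Finset.sum_mul] at h3
    have h4 := mul_geom_sum β n
    have h5 : β ^ n * (M.infoLaw φ γ₀ n).expect v ≤ β ^ n * ‖v‖ := by
      gcongr
      exact (le_abs_self _).trans (PMF.abs_expect_le_norm _ _)
    calc (1 - β) * v γ₀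
        ≤ (1 - β) * (C + (∑ i ∈ Finset.range n, β ^ i) * ε + β ^ n * ‖v‖) := by
          gcongr
          linarith
      _ = _ := by linear_combination -ε * h4
  have hp := tendsto_pow_atTop_nhds_zero_of_lt_one h0 h1
  have hlim : Tendsto (fun n : ℕ => (1 - β) * C + ε * (1 - β ^ n) + (1 - β) * (β ^ n * ‖v‖)) atTop
      (𝓝 ((1 - β) * C + ε * (1 - 0) + (1 - β) * (0 * ‖v‖))) :=
    ((hp.const_sub 1).const_mul ε |>.const_add _).add ((hp.mul_const _).const_mul _)
  have := ge_of_tendsto' hlim key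
  linarith

/-- The gain of a policy that is discount optimal for discount factors arbitrarily close to 1 is
the optimal average cost. -/
theorem U_eq_gain (hg : M.IsGainBias lam μ g w)
    (hμ : ∃ᶠ β in 𝓝[<] (1 : ℝ), 0 ≤ β ∧ β < 1 ∧ ∃ v, M.IsOptimal lam β μ v) (γ₀ : M.State) :
    M.U lam γ₀ = g γ₀ := by
  refine U_eq_of_forall_le hg γ₀ fun φ => le_limsup_of_forall_sum_le fun ε C hC => ?_
  have hlim : Tendsto (fun β : ℝ => ε + (1 - β) * (C + 2 * ‖w‖)) (𝓝[<] 1) (𝓝 ε) := by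
    have : Continuous fun β : ℝ => ε + (1 - β) * (C + 2 * ‖w‖) := by fun_prop
    simpa using (this.tendsto 1).mono_left nhdsWithin_le_nhds
  refine ge_of_tendsto_of_frequently hlim (hμ.mono ?_)
  rintro β ⟨h0, h1, v, hv⟩
  have hb : 0 < 1 - β := by linarith
  have h2 := hv.mul_le h0 h1 hC
  have h3 := mul_le_mul_of_nonneg_left (abs_le.1 (hg.abs_sub_le h0 h1 hv γ₀)).1 hb.le
  rw [mul_sub, mul_inv_cancel_left₀ hb.ne'] at h3
  linarith

/-- A vanishing gain yields a solution of the undiscounted Bellman equation. -/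
theorem exists_isOptimal_one (hg : M.IsGainBias lam μ 0 w)
    (hμ : ∃ᶠ β in 𝓝[<] (1 : ℝ), 0 ≤ β ∧ β < 1 ∧ ∃ v, M.IsOptimal lam β μ v) :
    ∃ v, M.IsOptimal lam 1 μ v := by
  obtain ⟨b, hb, h⟩ := exists_seq_forall_of_frequently hμ
  choose h0 h1 v hv using h
  -- With zero gain the pole disappears, so compactness applies; `μ` is fixed along the sequence, so
  -- its equalities survive the limit.
  have hbd : ∀ n, v n ∈ Metric.closedBall (0 : M.State → ℝ) (2 * ‖w‖) := fun n => by
    rw [mem_closedBall_zero_iff, pi_norm_le_iff_of_nonneg (by positivity)]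
    intro γ
    simpa using hg.abs_sub_le (h0 n) (h1 n) (hv n) γ
  obtain ⟨W, -, s, hs, hW⟩ := tendsto_subseq_of_bounded Metric.isBounded_closedBall hbd
  have hb' : Tendsto (b ∘ s) atTop (𝓝 1) :=
    (hb.mono_right nhdsWithin_le_nhds).comp hs.tendsto_atTop
  have hWγ := tendsto_pi_nhds.1 hW
  have hlim : ∀ γ d, Tendsto (fun n => M.g γ d lam + b (s n) * M.nextMean (v (s n)) γ d) atTop
      (𝓝 (M.g γ d lam + 1 * M.nextMean W γ d)) := fun γ d =>
    (hb'.mul (tendsto_finsetSum _ fun γ' _ => (hWγ γ').const_mul _)).const_add _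
  exact ⟨W, fun γ d => le_of_tendsto_of_tendsto' (hWγ γ) (hlim γ d) fun n => (hv (s n)).le γ d,
    fun γ => tendsto_nhds_unique (hWγ γ) ((hlim γ (μ γ)).congr fun n => ((hv (s n)).eq γ).symm)⟩

/-- `W` is a bias of `μ` with gain 0, so `μ` attains 0. No policy does better: a negative average
would send the partial sums to `-∞`, while they are at least `-2 * ‖W‖`. -/
theorem U_eq_zero_of_isOptimal_one {W : M.State → ℝ} (hW : M.IsOptimal lam 1 μ W)
    (γ₀ : M.State) : M.U lam γ₀ = 0 := by
  have hg : M.IsGainBias lam μ 0 W := by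
    refine ⟨map_zero _, ?_⟩
    ext γ
    simp only [Pi.add_apply, Pi.zero_apply, Pi.sub_apply, stepMap_apply]
    linarith [hW.eq γ]
  refine U_eq_of_forall_le hg γ₀ fun φ => le_limsup_of_forall_sum_le fun ε C hC => ?_
  rw [Pi.zero_apply]
  by_contra! hε
  obtain ⟨n, hn⟩ := exists_nat_gt ((C + 2 * ‖W‖) / -ε)
  rw [div_lt_iff₀ (by linarith)] at hn
  have h1 := hW.le_sum zero_le_one φ γ₀ n
  have h2 := (le_abs_self _).trans (PMF.abs_expect_le_norm (M.infoLaw φ γ₀ n) W)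
  have h3 := (abs_le.1 (norm_le_pi_norm W γ₀)).1
  have h4 := hC n
  simp only [one_pow, one_mul] at h1
  rw [Finset.sum_sub_distrib, Finset.sum_const, Finset.card_range, nsmul_eq_mul] at h4
  linarith

/-! ### Recurrence and harmonic functions. -/

theorem exists_recurrent (M : RemoteMDP S A) (μ : M.State → M.Decision) (γ : M.State) :
    ∃ γ', M.Accessible μ γ γ' ∧ M.Recurrent μ γ' := by
  -- A reachable state whose own reachable set is smallest must be recurrent.
  obtain ⟨γ', hγ', hmin⟩ := Set.exists_min_image {γ' | M.Accessible μ γ γ'}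
    (fun γ' => {x | M.Accessible μ γ' x}.ncard) (Set.toFinite _) ⟨γ, Relation.ReflTransGen.refl⟩
  refine ⟨γ', hγ', fun γ'' h => ?_⟩
  have hsub : {x | M.Accessible μ γ'' x} ⊆ {x | M.Accessible μ γ' x} := fun x hx => h.trans hx
  have heq := Set.eq_of_subset_of_ncard_le hsub (hmin γ'' (hγ'.trans h)) (Set.toFinite _)
  have : γ' ∈ {x | M.Accessible μ γ' x} := Relation.ReflTransGen.refl
  rwa [← heq] at this

/-- Maximum principle: an average equal to the maximum has only maximal terms of positive weight. -/
theorem eq_of_accessible_of_forall_le {F : M.State → ℝ} (hF : M.stepMap μ F = F) {γ γ' : M.State}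
    (hmax : ∀ x, F x ≤ F γ) (h : M.Accessible μ γ γ') : F γ' = F γ := by
  induction h with
  | refl => rfl
  | @tail b c _ hbc ih =>
    have h1 : ∑ x, M.transProb b (μ b) x * (F γ - F x) = 0 := by
      simp only [mul_sub, Finset.sum_sub_distrib, ← Finset.sum_mul, sum_transProb, one_mul]
      rw [← ih, sub_eq_zero]
      exact (congrFun hF b).symm
    have h2 := (Finset.sum_eq_zero_iff_of_nonneg fun x _ =>
      mul_nonneg (M.transProb_nonneg b (μ b) x) (sub_nonneg.2 (hmax x))).1 h1 c (Finset.mem_univ c)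
    rcases mul_eq_zero.1 h2 with h3 | h3
    · exact absurd h3 hbc.ne'
    · linarith

/-- Harmonic functions of a chain with a single recurrent class are constant. -/
theorem IsUnichain.eq_of_stepMap_eq (hM : M.IsUnichain) {F : M.State → ℝ}
    (hF : M.stepMap μ F = F) (γ γ' : M.State) : F γ = F γ' := by
  have : Nonempty M.State := ⟨γ⟩
  obtain ⟨x, hx⟩ := Finite.exists_max F
  obtain ⟨y, hy⟩ := Finite.exists_min F
  obtain ⟨x', hxx', hx'⟩ := M.exists_recurrent μ x
  obtain ⟨y', hyy', hy'⟩ := M.exists_recurrent μ y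
  -- The recurrent state `y'` is reached from both a maximum and a minimum of `F`, so the two values
  -- agree.
  have h1 : F y' = F x := eq_of_accessible_of_forall_le hF hx (hxx'.trans (hM μ x' y' hx' hy'))
  have h2 : (-F) y' = (-F) y := eq_of_accessible_of_forall_le (by rw [map_neg, hF])
    (fun z => neg_le_neg (hy z)) hyy'
  have h3 : F x = F y := by rw [← h1]; exact neg_injective h2
  linarith [hx γ, hx γ', hy γ, hy γ']

/-! ### The system (1) as a normalized Bellman equation. -/

omit [Fintype S] [DecidableEq S] [Fintype A] [DecidableEq A] in
theorem f_pos (M : RemoteMDP S A) (z : M.waits) : 0 < M.f z := by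
  have h1 : (1 : ℝ) ≤ M.delayLaw.expect fun y => ((y : ℕ) : ℝ) := by
    rw [← M.delayLaw.expect_const 1]
    exact PMF.expect_mono _ fun y => by exact_mod_cast M.delays_pos y y.2
  have h2 : (0 : ℝ) ≤ ((z : ℕ) : ℝ) := Nat.cast_nonneg _
  rw [f]
  linarith

theorem isOptimal_one_sub_const {W : M.State → ℝ} (hW : M.IsOptimal lam 1 μ W) (r : ℝ) :
    M.IsOptimal lam 1 μ fun γ => W γ - r := by
  have h : ∀ γ d, M.nextMean (fun γ => W γ - r) γ d = M.nextMean W γ d - r := fun γ d => by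
    rw [M.nextMean_sub W fun _ => r, nextMean_const]
  refine ⟨fun γ d => ?_, fun γ => ?_⟩
  · rw [h]
    linarith [hW.le γ d]
  · rw [h]
    linarith [hW.eq γ]

theorem eq_inf'_iff {ι : Type*} [Fintype ι] [Nonempty ι] (F : ι → ℝ) (r : ℝ) :
    r = Finset.univ.inf' Finset.univ_nonempty F ↔ (∀ d, r ≤ F d) ∧ ∃ d, r = F d := by
  obtain ⟨d₀, -, hd₀⟩ := Finset.exists_mem_eq_inf' Finset.univ_nonempty F
  constructor
  · rintro rfl
    exact ⟨fun d => Finset.inf'_le _ (Finset.mem_univ d), d₀, hd₀⟩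
  · rintro ⟨h1, d, hd⟩
    exact le_antisymm (Finset.le_inf' _ _ fun d _ => h1 d)
      (hd ▸ Finset.inf'_le _ (Finset.mem_univ d))

variable [Nonempty A]

/-- Multiplying by the positive durations `f` turns the minimal ratio into a minimum equal to zero.
-/
theorem eq_H_iff (γref : M.State) (W : M.State → ℝ) (h : ℝ) :
    h = M.H γref W ↔ 0 = M.T W h γref := by
  have hf := fun z => M.f_pos z
  simp only [H, T, eq_inf'_iff, g]
  refine and_congr (forall_congr' fun d => ?_) (exists_congr fun d => ?_)
  · rw [le_div_iff₀ (hf d.1)]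
    constructor <;> intro <;> linarith
  · rw [eq_div_iff (hf d.1).ne']
    constructor <;> intro <;> linarith

theorem solvesSystem_iff (γref : M.State) (W : M.State → ℝ) (h : ℝ) :
    M.SolvesSystem γref W h ↔ (∃ μ, M.IsOptimal h 1 μ W) ∧ W γref = 0 := by
  have h1 : (∀ γ, W γ = M.T W h γ) ↔ ∃ μ, M.IsOptimal h 1 μ W := by
    simp only [T, eq_inf'_iff]
    constructor
    · intro hW
      choose hle μ hμ using hW
      exact ⟨μ, by simpa using hle, by simpa using hμ⟩
    · rintro ⟨μ, hμ⟩ γ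
      exact ⟨fun d => by simpa using hμ.le γ d, μ γ, by simpa using hμ.eq γ⟩
  rw [← h1]
  change (∀ γ, W γ = M.T W h γ) ∧ h = M.H γref W ↔ _
  refine and_congr_right fun hW => ?_
  rw [eq_H_iff, ← hW γref, eq_comm]

theorem exists_solvesSystem_of_isOptimal (γref : M.State) {W : M.State → ℝ}
    (hW : M.IsOptimal lam 1 μ W) : ∃ W, M.SolvesSystem γref W lam :=
  ⟨fun γ => W γ - W γref, (solvesSystem_iff _ _ _).2
    ⟨⟨μ, isOptimal_one_sub_const hW _⟩, sub_self _⟩⟩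

theorem U_eq_zero_of_solvesSystem {γref : M.State} {W : M.State → ℝ}
    (hW : M.SolvesSystem γref W lam) (γ₀ : M.State) : M.U lam γ₀ = 0 :=
  let ⟨⟨_, hμ⟩, _⟩ := (solvesSystem_iff _ _ _).1 hW
  U_eq_zero_of_isOptimal_one hμ γ₀

end RemoteMDP

theorem theorem2 {S A : Type*} [Fintype S] [DecidableEq S] [Fintype A] [DecidableEq A] [Nonempty A]
    (M : RemoteMDP S A) (γref : M.State) (h : ℝ) :
    ((∀ γ₀ : M.State, M.U h γ₀ = 0) ↔ ∃ W : M.State → ℝ, M.SolvesSystem γref W h) ∧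
    (M.IsUnichain → ∀ γ₀ : M.State,
      (M.U h γ₀ = 0 ↔ ∃ W : M.State → ℝ, M.SolvesSystem γref W h)) ∧
    (∀ W : M.State → ℝ,
      M.SolvesSystem γref W h ↔ W = M.Q γref W ∧ h = M.H γref W) := by
  obtain ⟨μ, hμ⟩ := M.exists_frequently_isOptimal h
  obtain ⟨g, w, hg⟩ := M.exists_isGainBias h μ
  have hsolve : g = 0 → ∃ W, M.SolvesSystem γref W h := by
    rintro rfl
    obtain ⟨v, hv⟩ := RemoteMDP.exists_isOptimal_one hg hμ
    exact RemoteMDP.exists_solvesSystem_of_isOptimal γref hv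
  refine ⟨⟨fun hU => hsolve (funext fun γ => ?_), fun ⟨W, hW⟩ => RemoteMDP.U_eq_zero_of_solvesSystem hW⟩,
    fun hM γ₀ => ⟨fun hU => hsolve (funext fun γ => ?_),
      fun ⟨W, hW⟩ => RemoteMDP.U_eq_zero_of_solvesSystem hW γ₀⟩, fun W => ?_⟩
  · rw [← RemoteMDP.U_eq_gain hg hμ, hU, Pi.zero_apply]
  -- The gain is harmonic for `μ`, hence constant in a unichain.
  · rw [hM.eq_of_stepMap_eq hg.fixed γ γ₀, ← RemoteMDP.U_eq_gain hg hμ, hU, Pi.zero_apply]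
  · change (∀ γ, W γ = M.T W h γ) ∧ h = M.H γref W ↔ W = M.T W (M.H γref W) ∧ h = M.H γref W
    refine and_congr_left fun hh => ?_
    rw [← hh, funext_iff]
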